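/- A growth function is a nondecreasing $\Phi:[0,\infty)\to[0,\infty)$ with $\lim_{t\to0}\Phi(t)=\Phi(0)=0$, $\Phi(t)>0$ for $t>0$ and $\lim_{t\to\infty}\Phi(t)=\infty$. Let $\mathscr U$ be the set of growth functions $\Phi$ that are convex and of class $C^1$ on $[0,\infty)$, for which $t\mapsto \Phi(t)/t$ is nondecreasing on $(0,\infty)$, and which are of some upper type $p\ge 1$: there is $C>1$ with $\Phi(st)\le Ct^p\Phi(s)$ for all $t\ge1$, $s\ge0$. A function $\Phi$ satisfies $\Delta_2$ if there is $K>1$ with $\Phi(2t)\le K\Phi(t)$ for all $t>0$, and a convex $\Phi$ satisfies $\nabla_2$ if both $\Phi$ and its complementary function $\Psi(s)=\sup_{t\ge0}\{st-\Phi(t)\}\in[0,\infty]$ satisfy $\Delta_2$. Let $\mathbb C_+=\{z\in\mathbb C:\operatorname{Im}z>0\}$ and, for $\alpha>-1$, $dV_\alpha(x+iy)=y^\alpha\,dx\,dy$. Let $L^\Phi(\mathbb C_+,dV_\alpha)$ be the space of (classes of) measurable $F:\mathbb C_+\to\mathbb C$ with $$\|F\|^{lux}=\inf\Big\{\lambda>0:\int_{\mathbb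 C_+}\Phi\big(|F|/\lambda\big)\,dV_\alpha\le1\Big\}<\infty,$$ and let $A^\Phi_\alpha(\mathbb C_+)$ be its subspace of analytic functions, with the same norm. Put $K_\alpha(z,\omega)=\big(\tfrac{z-\overline\omega}{i}\big)^{-\alpha-2}$ (principal power) and $$\mathcal P_\alpha F(z)=\int_{\mathbb C_+}K_\alpha(z,\omega)F(\omega)\,dV_\alpha(\omega),\qquad \mathcal P^+_\alpha F(z)=\int_{\mathbb C_+}|K_\alpha(z,\omega)|F(\omega)\,dV_\alpha(\omega),\qquad z\in\mathbb C_+.$$ **Theorem.** Let $\alpha>-1$ and let $\Phi\in\mathscr U$ satisfy $\nabla_2$. Then for every $F\in L^\Phi(\mathbb C_+,dV_\alpha)$ and $z\in\mathbb C_+$ both integrals converge absolutely, and there are constants $C,C'\ge 0$ depending only on $\alpha$ and $\Phi$ such that: (i) $\mathcal P_\alpha$ maps $L^\Phi(\mathbb C_+,dV_\alpha)$ onto $A^\Phi_\alpha(\mathbb C_+)$, and $\|\mathcal P_\alpha F\|^{lux}\le C\|F\|^{lux}$ for all $F\in L^\Phi(\mathbb C_+,dV_\alpha)$; (ii) $\mathcal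 P^+_\alpha$ maps $L^\Phi(\mathbb C_+,dV_\alpha)$ into itself, and $\|\mathcal P^+_\alpha F\|^{lux}\le C'\|F\|^{lux}$ for all $F\in L^\Phi(\mathbb C_+,dV_\alpha)$. -/

import Mathlib

open MeasureTheory Set Filter Topology
open scoped ENNReal NNReal ComplexConjugate

namespace BergmanOrlicz

/-- Growth functions on `[0, ∞)`. A function on `[0, ∞)` is represented by a function `ℝ → ℝ`
of which only the values on `[0, ∞)` are ever used. -/
structure IsGrowthFunction (Φ : ℝ → ℝ) : Prop where
  monotoneOn : MonotoneOn Φ (Ici 0)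
  map_zero : Φ 0 = 0
  tendsto_zero : Tendsto Φ (𝓝[>] 0) (𝓝 0)
  pos : ∀ t, 0 < t → 0 < Φ t
  tendsto_atTop : Tendsto Φ atTop atTop

/-- `Φ` is of upper type `p`. -/
def IsUpperType (Φ : ℝ → ℝ) (p : ℝ) : Prop :=
  ∃ C : ℝ, 1 < C ∧ ∀ t, 1 ≤ t → ∀ s, 0 ≤ s → Φ (s * t) ≤ C * t ^ p * Φ s

/-- The class `𝒰`: growth functions of some upper type `p ≥ 1` with `Φ(t)/t` nondecreasing,
which are moreover convex and of class `C¹` on `[0, ∞)`. -/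
structure ClassU (Φ : ℝ → ℝ) : Prop where
  growth : IsGrowthFunction Φ
  upperType : ∃ p : ℝ, 1 ≤ p ∧ IsUpperType Φ p
  monotoneOn_div : MonotoneOn (fun t => Φ t / t) (Ioi 0)
  contDiffOn : ContDiffOn ℝ 1 Φ (Ici 0)
  convexOn : ConvexOn ℝ (Ici 0) Φ

/-- The complementary function `Ψ(s) = sup_{t ≥ 0} (s t - Φ(t))`, with values in `[0, ∞]`
(the supremum may be infinite; it is nonnegative when `Φ 0 = 0`, because of `t = 0`). -/
noncomputable def complementary (Φ : ℝ → ℝ) (s : ℝ) : ℝ≥0∞ :=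
  ⨆ (t : ℝ) (_ : 0 ≤ t), ENNReal.ofReal (s * t - Φ t)

/-- The `Δ₂`-condition, for functions with values in `[0, ∞]`. -/
def Delta2 (Φ : ℝ → ℝ≥0∞) : Prop :=
  ∃ K : ℝ, 1 < K ∧ ∀ t, 0 < t → Φ (2 * t) ≤ ENNReal.ofReal K * Φ t

/-- The `∇₂`-condition: `Φ` and its complementary function both satisfy `Δ₂`. -/
def Nabla2 (Φ : ℝ → ℝ) : Prop :=
  Delta2 (fun t => ENNReal.ofReal (Φ t)) ∧ Delta2 (complementary Φ)

/-- The Luxemburg (quasi-)norm, as an element of `[0, ∞]`. -/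
noncomputable def luxNorm {X : Type*} [MeasurableSpace X] (Φ : ℝ → ℝ) (μ : Measure X)
    (f : X → ℂ) : ℝ≥0∞ :=
  ⨅ (l : ℝ) (_ : 0 < l) (_ : ∫⁻ x, ENNReal.ofReal (Φ (‖f x‖ / l)) ∂μ ≤ 1), ENNReal.ofReal l

/-- `f` (a representative of an a.e.-class) belongs to the Orlicz space `L^Φ(X, dμ)`. -/
def MemOrlicz {X : Type*} [MeasurableSpace X] (Φ : ℝ → ℝ) (μ : Measure X) (f : X → ℂ) : Prop :=
  AEStronglyMeasurable f μ ∧ luxNorm Φ μ f < ∞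

/-- The open upper half-plane `ℂ₊`. -/
def upperPlane : Set ℂ := {z | 0 < z.im}

/-- The measure `dV_α = (Im z)^α dx dy` on `ℂ₊`, as a measure on `ℂ` that does not charge the
complement of `ℂ₊`. -/
noncomputable def V (α : ℝ) : Measure ℂ :=
  (volume.restrict upperPlane).withDensity fun z => ENNReal.ofReal (z.im ^ α)

/-- `F` belongs to the Bergman-Orlicz space `A^Φ_α(ℂ₊)`. -/
def MemBergmanOrlicz (Φ : ℝ → ℝ) (α : ℝ) (F : ℂ → ℂ) : Prop :=
  DifferentiableOn ℂ F upperPlane ∧ MemOrlicz Φ (V α) F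

/-- The Bergman kernel `K_α(z, w) = ((z - w̄) / i)^(-α-2)`; for `z, w ∈ ℂ₊` the base has positive
real part and the power is the principal one. -/
noncomputable def kernel (α : ℝ) (z w : ℂ) : ℂ :=
  ((z - conj w) / Complex.I) ^ ((-α - 2 : ℝ) : ℂ)

/-- The Bergman projection `P_α`. -/
noncomputable def bergmanProj (α : ℝ) (F : ℂ → ℂ) (z : ℂ) : ℂ :=
  ∫ w, kernel α z w * F w ∂(V α)

/-- The positive Bergman operator `P⁺_α`. -/
noncomputable def bergmanPos (α : ℝ) (F : ℂ → ℂ) (z : ℂ) : ℂ :=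
  ∫ w, (‖kernel α z w‖ : ℂ) * F w ∂(V α)

end BergmanOrlicz

open BergmanOrlicz

namespace BergmanOrlicz

variable {α : ℝ} {Φ : ℝ → ℝ}

/-! Boundedness is a Schur test carried out directly on the modular, without interpolation. The
upper type and the `Δ₂` condition on the complementary function give `Φ (t * r) ≤ C * (r ^ p + r ^
q) * Φ t` with `p, q > 1` (`ClassU.exists_dilation_bound`). Write `r = w.im / z.im` and factor `|K|
f = (|K| r ^ (-s)) (f r ^ s)`. The first factor has mass at most `c` in `w`, uniformly in `z`, by a
Forelli–Rudin estimate, so Jensen's inequality applies. The dilation bound then takes `r ^ s` out of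
`Φ`, which leaves `Φ ∘ f` integrated against `|K| (r ^ (s(p-1)) + r ^ (s(q-1)))`. This kernel has
bounded mass in `z`, so Tonelli's theorem gives a modular bound (`ClassU.exists_modular_le`), and
convexity turns it into a norm bound. Both operators are dominated by the integral of `|K| |F|`, so
one estimate serves for both.

Analyticity of the projection is differentiation under the integral sign. For surjectivity, a Cayley
map carries the integral of an analytic `G` against the kernel to a radial weight times a
holomorphic function on the disc. The mean value property gives `P_α G = c G` with `c = 2 ^ (-α) π /
(α + 1)` (`bergmanProj_eq_of_differentiableOn`), so `c⁻¹ G` is a preimage of `G`. -/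

theorem IsGrowthFunction.nonneg (h : IsGrowthFunction Φ) {t : ℝ} (ht : 0 ≤ t) : 0 ≤ Φ t := by
  have := h.monotoneOn (mem_Ici.2 le_rfl) (mem_Ici.2 ht) ht
  rwa [h.map_zero] at this

/-! ### Convexity, growth exponents and Jensen's inequality for `Φ`. -/

theorem ClassU.continuous_comp {X : Type*} [TopologicalSpace X] (h : ClassU Φ) {g : X → ℝ}
    (hg : Continuous g) (hg0 : ∀ x, 0 ≤ g x) : Continuous fun x => Φ (g x) :=
  h.contDiffOn.continuousOn.comp_continuous hg hg0

/-- Supporting lines of a function of class `𝒰`. -/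
theorem ClassU.exists_subgradient (h : ClassU Φ) {u : ℝ} (hu : 0 < u) :
    ∃ s : ℝ, 0 < s ∧ ∀ t, 0 ≤ t → Φ u + s * (t - u) ≤ Φ t := by
  have hd : HasDerivAt Φ (deriv Φ u) u :=
    ((h.contDiffOn.differentiableOn one_ne_zero).differentiableAt (Ici_mem_nhds hu)).hasDerivAt
  have key : ∀ t, 0 ≤ t → Φ u + deriv Φ u * (t - u) ≤ Φ t := by
    intro t ht
    rcases lt_trichotomy t u with hlt | rfl | hlt
    · have := h.convexOn.slope_le_of_hasDerivAt ht hu.le hlt hd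
      rw [slope_def_field, div_le_iff₀ (by linarith)] at this
      linarith
    · simp
    · have := h.convexOn.le_slope_of_hasDerivAt hu.le ht hlt hd
      rw [slope_def_field, le_div_iff₀ (by linarith)] at this
      linarith
  refine ⟨deriv Φ u, ?_, key⟩
  have h0 := key 0 le_rfl
  rw [h.growth.map_zero] at h0
  have := h.growth.pos u hu
  by_contra! hneg
  nlinarith

/-- The `Δ₂`-condition of the complementary function, transported to the function. -/
theorem ClassU.exists_contraction (h : ClassU Φ) (h2 : Delta2 (complementary Φ)) :
    ∃ K : ℝ, 2 < K ∧ ∀ t, 0 ≤ t → Φ (t * (2 / K)) ≤ (2 / K / 2) * Φ t := by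
  obtain ⟨K, hK, hΨ⟩ := h2
  refine ⟨max K 3, lt_max_of_lt_right (by norm_num), fun t ht => ?_⟩
  set L := max K 3 with hL
  have hL3 : 3 ≤ L := le_max_right _ _
  have hL0 : 0 < L := by linarith
  rcases ht.eq_or_lt with rfl | ht
  · simp [h.growth.map_zero]
  -- A slope `s` at `u` gives equality in Young's inequality: `Ψ(s) = s u - Φ(u)`. Since `L s u = 2
  -- s t`, the linear terms cancel in `2 s t - Φ(t) ≤ Ψ(2s) ≤ L Ψ(s)`, leaving `L Φ(u) ≤ Φ(t)`.
  set u := t * (2 / L) with hu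
  have hu0 : 0 < u := by positivity
  obtain ⟨s, hs, hsub⟩ := h.exists_subgradient hu0
  have hYoung : complementary Φ s ≤ ENNReal.ofReal (s * u - Φ u) := by
    refine iSup₂_le fun r hr => ENNReal.ofReal_le_ofReal ?_
    have := hsub r hr
    linarith
  have hnn : 0 ≤ s * u - Φ u := by
    have := hsub 0 le_rfl
    rw [h.growth.map_zero] at this
    linarith
  have h1 : ENNReal.ofReal (2 * s * t - Φ t) ≤ ENNReal.ofReal (L * (s * u - Φ u)) := by
    calc ENNReal.ofReal (2 * s * t - Φ t) ≤ complementary Φ (2 * s) :=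
          le_iSup₂_of_le (f := fun (r : ℝ) (_ : 0 ≤ r) => ENNReal.ofReal (2 * s * r - Φ r))
            t ht.le le_rfl
      _ ≤ ENNReal.ofReal K * complementary Φ s := hΨ s hs
      _ ≤ ENNReal.ofReal L * ENNReal.ofReal (s * u - Φ u) := by
          gcongr
          exact le_max_left _ _
      _ = _ := (ENNReal.ofReal_mul hL0.le).symm
  rw [ENNReal.ofReal_le_ofReal_iff (by positivity)] at h1
  have h3 : L * (s * u) = 2 * s * t := by rw [hu]; field_simp
  have h4 : L * Φ u ≤ Φ t := by linarith
  have h5 : 2 / L / 2 * Φ t = Φ t / L := by field_simp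
  rw [h5, le_div_iff₀ hL0]
  linarith

/-- A function of class `𝒰` satisfying `∇₂` is of lower type `q > 1`. -/
theorem ClassU.exists_lowerType (h : ClassU Φ) (h2 : Delta2 (complementary Φ)) :
    ∃ q C : ℝ, 1 < q ∧ 0 < C ∧ ∀ r, 0 < r → r ≤ 1 → ∀ s, 0 ≤ s →
      Φ (s * r) ≤ C * r ^ q * Φ s := by
  obtain ⟨K, hK, hc⟩ := h.exists_contraction h2
  set a := 2 / K with ha
  have ha0 : 0 < a := by positivity
  have ha1 : a < 1 := by rw [ha, div_lt_one (by linarith)]; exact hK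
  have hla : Real.log a < 0 := Real.log_neg ha0 ha1
  -- Chosen so that `a ^ q = a / 2`; the factor `1 / 2` gained over convexity is what makes `q > 1`.
  set q := Real.log (a / 2) / Real.log a with hq
  have hq1 : 1 < q := by
    rw [hq, lt_div_iff_of_neg hla, one_mul]
    exact Real.log_lt_log (by positivity) (by linarith)
  have haq : a ^ q = a / 2 := by
    rw [Real.rpow_def_of_pos ha0, hq, mul_div_cancel₀ _ hla.ne, Real.exp_log (by positivity)]
  have hiter : ∀ n : ℕ, ∀ s, 0 ≤ s → Φ (s * a ^ n) ≤ (a ^ n) ^ q * Φ s := by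
    intro n
    induction n with
    | zero => intro s _; simp
    | succ n ih =>
      intro s hs
      calc Φ (s * a ^ (n + 1)) = Φ (s * a ^ n * a) := by ring_nf
        _ ≤ a / 2 * Φ (s * a ^ n) := hc _ (by positivity)
        _ ≤ a / 2 * ((a ^ n) ^ q * Φ s) := by gcongr; exact ih s hs
        _ = (a ^ (n + 1)) ^ q * Φ s := by
          rw [pow_succ, Real.mul_rpow (by positivity) ha0.le, haq]; ring
  refine ⟨q, (a ^ q)⁻¹, hq1, by positivity, fun r hr hr1 s hs => ?_⟩
  obtain ⟨n, hn1, hn2⟩ := exists_nat_pow_near_of_lt_one hr hr1 ha0 ha1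
  have hΦ := h.growth.nonneg hs
  calc Φ (s * r) ≤ Φ (s * a ^ n) :=
        h.growth.monotoneOn (mem_Ici.2 (by positivity)) (mem_Ici.2 (by positivity)) (by gcongr)
    _ ≤ (a ^ n) ^ q * Φ s := hiter n s hs
    _ = (a ^ q)⁻¹ * (a ^ (n + 1)) ^ q * Φ s := by
        rw [pow_succ, Real.mul_rpow (by positivity) ha0.le]
        field_simp
    _ ≤ (a ^ q)⁻¹ * r ^ q * Φ s := by gcongr

/-- Two-sided power control of the dilations of a function of class `𝒰` satisfying `∇₂`. -/
theorem ClassU.exists_dilation_bound (h : ClassU Φ) (h2 : Nabla2 Φ) :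
    ∃ p q C : ℝ, 1 < p ∧ 1 < q ∧ 0 < C ∧ ∀ r, 0 < r → ∀ s, 0 ≤ s →
      Φ (s * r) ≤ C * (r ^ p + r ^ q) * Φ s := by
  obtain ⟨p, hp, C, hC, hup⟩ := h.upperType
  obtain ⟨q, D, hq, hD, hlow⟩ := h.exists_lowerType h2.2
  -- The upper type may be `1`; raising it makes the exponent `s * (p - 1)` of the Schur test
  -- strictly positive.
  refine ⟨max p 2, q, max C D, by simp, hq, by positivity, fun r hr s hs => ?_⟩
  have hΦ := h.growth.nonneg hs
  rcases le_total r 1 with hr1 | hr1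
  · refine (hlow r hr hr1 s hs).trans ?_
    gcongr
    · exact le_max_right _ _
    · have : 0 ≤ r ^ max p 2 := by positivity
      linarith
  · refine (hup r hr1 s hs).trans ?_
    gcongr
    · exact le_max_left _ _
    · have h1 : r ^ p ≤ r ^ max p 2 := Real.rpow_le_rpow_of_exponent_le hr1 (le_max_left _ _)
      have : 0 ≤ r ^ q := by positivity
      linarith

theorem ClassU.map_div_le (h : ClassU Φ) {c t : ℝ} (hc : 1 ≤ c) (ht : 0 ≤ t) :
    Φ (t / c) ≤ Φ t / c := by
  have hc0 : 0 < c := by linarith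
  have := h.convexOn.2 (mem_Ici.2 ht) (mem_Ici.2 le_rfl) (by positivity : 0 ≤ c⁻¹)
    (sub_nonneg.2 (inv_le_one_of_one_le₀ hc)) (by ring)
  simpa [h.growth.map_zero, div_eq_inv_mul] using this

theorem ClassU.le_one_add_div (h : ClassU Φ) {t : ℝ} (ht : 0 ≤ t) : t ≤ 1 + Φ t / Φ 1 := by
  have h1 := h.growth.pos 1 one_pos
  have h2 := h.growth.nonneg ht
  rcases le_total t 1 with ht1 | ht1
  · have : 0 ≤ Φ t / Φ 1 := by positivity
    linarith
  · have := h.monotoneOn_div (mem_Ioi.2 one_pos) (mem_Ioi.2 (by linarith)) ht1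
    simp only [div_one] at this
    rw [le_div_iff₀ (by linarith)] at this
    have : t ≤ Φ t / Φ 1 := by rw [le_div_iff₀ h1]; linarith
    linarith

/-- Jensen's inequality for a weight of total mass at most `c`. -/
theorem ClassU.map_integral_le (h : ClassU Φ) {X : Type*} [MeasurableSpace X] {μ : Measure X}
    {k t : X → ℝ} {c : ℝ} (hc : 0 < c) (hk : ∀ᵐ x ∂μ, 0 ≤ k x) (ht : ∀ᵐ x ∂μ, 0 ≤ t x)
    (hki : Integrable k μ) (hkc : ∫ x, k x ∂μ ≤ c) (hkt : Integrable (fun x => k x * t x) μ)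
    (hkΦ : Integrable (fun x => k x * Φ (t x)) μ) :
    Φ (c⁻¹ * ∫ x, k x * t x ∂μ) ≤ c⁻¹ * ∫ x, k x * Φ (t x) ∂μ := by
  set A := c⁻¹ * ∫ x, k x * t x ∂μ with hA
  have hA0 : 0 ≤ A := by
    refine mul_nonneg (by positivity) (integral_nonneg_of_ae ?_)
    filter_upwards [hk, ht] with x h1 h2 using mul_nonneg h1 h2
  rcases hA0.eq_or_lt with h0 | hpos
  · rw [← h0, h.growth.map_zero]
    refine mul_nonneg (by positivity) (integral_nonneg_of_ae ?_)
    filter_upwards [hk, ht] with x h1 h2 using mul_nonneg h1 (h.growth.nonneg h2)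
  obtain ⟨s, hs, hsub⟩ := h.exists_subgradient hpos
  -- The supporting line at `A` has a nonpositive intercept, so replacing the mass of `k` by the
  -- larger `c` only lowers the left side. This is why mass at most `c` suffices.
  have hneg : Φ A - s * A ≤ 0 := by
    have := hsub 0 le_rfl
    rw [h.growth.map_zero] at this
    linarith
  have hint : (Φ A - s * A) * ∫ x, k x ∂μ + s * ∫ x, k x * t x ∂μ ≤ ∫ x, k x * Φ (t x) ∂μ := by
    rw [← integral_const_mul, ← integral_const_mul,
      ← integral_add (hki.const_mul _) (hkt.const_mul _)]
    refine integral_mono_ae ((hki.const_mul _).add (hkt.const_mul _)) hkΦ ?_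
    filter_upwards [hk, ht] with x h1 h2
    have := mul_le_mul_of_nonneg_left (hsub (t x) h2) h1
    linarith
  have hAc : ∫ x, k x * t x ∂μ = c * A := by rw [hA]; field_simp
  rw [hAc] at hint
  have : (Φ A - s * A) * c ≤ (Φ A - s * A) * ∫ x, k x ∂μ := mul_le_mul_of_nonpos_left hkc hneg
  rw [← div_eq_inv_mul, le_div_iff₀ hc]
  linarith

/-! ### The measure `V α` and integral estimates for the kernel. -/

theorem measurableSet_upperPlane : MeasurableSet upperPlane :=
  measurableSet_lt measurable_const Complex.measurable_im

theorem ae_mem_upperPlane (α : ℝ) : ∀ᵐ w ∂(V α), w ∈ upperPlane :=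
  (withDensity_absolutelyContinuous _ _).ae_le (ae_restrict_mem measurableSet_upperPlane)

instance : SFinite (V α) := by unfold V; infer_instance

theorem lintegral_V (α : ℝ) {f : ℂ → ℝ≥0∞} (hf : Measurable f) :
    ∫⁻ w, f w ∂(V α) = ∫⁻ v in Ioi (0 : ℝ), ∫⁻ u : ℝ, ENNReal.ofReal (v ^ α) * f ⟨u, v⟩ := by
  have hm : Measurable fun z : ℂ => ENNReal.ofReal (z.im ^ α) := by fun_prop
  rw [V, lintegral_withDensity_eq_lintegral_mul _ hm hf]
  rw [← lintegral_indicator measurableSet_upperPlane,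
    ← Complex.volume_preserving_equiv_real_prod.symm.lintegral_comp
      ((hm.mul hf).indicator measurableSet_upperPlane), Measure.volume_eq_prod,
    lintegral_prod_symm, ← lintegral_indicator measurableSet_Ioi]
  · refine lintegral_congr fun v => ?_
    by_cases hv : 0 < v
    · rw [indicator_of_mem (mem_Ioi.2 hv)]
      refine lintegral_congr fun u => ?_
      rw [indicator_of_mem]
      · rfl
      · exact hv
    · rw [indicator_of_notMem (by simpa using hv)]
      refine Eq.trans (lintegral_congr fun u => ?_) (lintegral_zero (μ := (volume : Measure ℝ)))
      exact indicator_of_notMem (s := upperPlane) hv _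
  · exact (((hm.mul hf).indicator measurableSet_upperPlane).comp
      Complex.measurableEquivRealProd.symm.measurable).aemeasurable

theorem norm_kernel (α : ℝ) (z w : ℂ) : ‖kernel α z w‖ = ‖z - conj w‖ ^ (-α - 2) := by
  rw [kernel, Complex.norm_cpow_real, norm_div, Complex.norm_I, div_one]

theorem norm_kernel_comm (α : ℝ) (z w : ℂ) : ‖kernel α z w‖ = ‖kernel α w z‖ := by
  rw [norm_kernel, norm_kernel, ← Complex.norm_conj (z - conj w), map_sub, Complex.conj_conj,
    norm_sub_rev]

theorem measurable_kernel (α : ℝ) : Measurable (Function.uncurry (kernel α)) := by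
  unfold kernel Function.uncurry
  fun_prop

theorem half_le_norm_sub_conj (z w : ℂ) :
    (|z.re - w.re| + (z.im + w.im)) / 2 ≤ ‖z - conj w‖ := by
  have h1 := Complex.abs_re_le_norm (z - conj w)
  have h2 := (le_abs_self _).trans (Complex.abs_im_le_norm (z - conj w))
  simp only [Complex.sub_re, Complex.sub_im, Complex.conj_re, Complex.conj_im, sub_neg_eq_add]
    at h1 h2
  linarith

theorem im_add_im_le_norm_sub_conj (z w : ℂ) : z.im + w.im ≤ ‖z - conj w‖ := by
  have h2 := (le_abs_self _).trans (Complex.abs_im_le_norm (z - conj w))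
  simpa using h2

/-- Integration of the kernel along horizontal lines. -/
theorem exists_lintegral_kernel_horizontal_le (hα : -1 < α) :
    ∃ C : ℝ, 0 < C ∧ ∀ z : ℂ, 0 < z.im → ∀ v : ℝ, 0 < v →
      ∫⁻ u : ℝ, ENNReal.ofReal ‖kernel α z ⟨u, v⟩‖ ≤
        ENNReal.ofReal (C * (z.im + v) ^ (-α - 1)) := by
  set g : ℝ → ℝ := fun u => (1 + ‖u‖) ^ (-(α + 2)) with hg
  have hgi : Integrable g := integrable_one_add_norm (by simp; linarith)
  have hg0 : ∀ u, 0 ≤ g u := fun u => by positivity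
  refine ⟨2 ^ (α + 2) * ((∫ u, g u) + 1), mul_pos (by positivity)
    (by have := integral_nonneg (μ := volume) (show 0 ≤ g from hg0); linarith), fun z hz v hv => ?_⟩
  set Y := z.im + v with hY
  have hY0 : 0 < Y := by positivity
  have hle : ∀ u : ℝ, ‖kernel α z ⟨u, v⟩‖ ≤ 2 ^ (α + 2) * Y ^ (-α - 2) * g ((z.re - u) / Y) := by
    intro u
    rw [norm_kernel]
    have h1 : (2 : ℝ)⁻¹ * (Y * (1 + ‖(z.re - u) / Y‖)) ≤ ‖z - conj (⟨u, v⟩ : ℂ)‖ := by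
      refine le_trans (le_of_eq ?_) (half_le_norm_sub_conj z ⟨u, v⟩)
      rw [norm_div, Real.norm_eq_abs, Real.norm_of_nonneg hY0.le]
      field_simp
      ring
    refine (Real.rpow_le_rpow_of_nonpos (by positivity) h1 (by linarith)).trans (le_of_eq ?_)
    rw [Real.mul_rpow (by positivity) (by positivity), Real.mul_rpow (by positivity)
      (by positivity), hg, Real.inv_rpow (by positivity), ← Real.rpow_neg (by positivity)]
    ring_nf
  have hint : Integrable fun u => 2 ^ (α + 2) * Y ^ (-α - 2) * g ((z.re - u) / Y) :=
    ((hgi.comp_div hY0.ne').comp_sub_left z.re).const_mul _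
  calc ∫⁻ u : ℝ, ENNReal.ofReal ‖kernel α z ⟨u, v⟩‖
      ≤ ∫⁻ u : ℝ, ENNReal.ofReal (2 ^ (α + 2) * Y ^ (-α - 2) * g ((z.re - u) / Y)) :=
        lintegral_mono fun u => ENNReal.ofReal_le_ofReal (hle u)
    _ = ENNReal.ofReal (∫ u : ℝ, 2 ^ (α + 2) * Y ^ (-α - 2) * g ((z.re - u) / Y)) :=
        (ofReal_integral_eq_lintegral_ofReal hint
          (ae_of_all _ fun u => mul_nonneg (by positivity) (hg0 _))).symm
    _ ≤ _ := by
        refine ENNReal.ofReal_le_ofReal ?_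
        rw [integral_const_mul, integral_sub_left_eq_self (fun u => g (u / Y)) volume z.re,
          Measure.integral_comp_div g, abs_of_pos hY0, smul_eq_mul]
        have : Y ^ (-α - 1) = Y ^ (-α - 2) * Y := by
          rw [← Real.rpow_add_one hY0.ne']; ring_nf
        rw [this]
        have h3 : 0 ≤ 2 ^ (α + 2) * (Y ^ (-α - 2) * Y) := by positivity
        linarith

/-- Split at `v = y` and replace `y + v` by the larger of the two. The condition `s < α + 1` gives
convergence at `0`, and `0 < s` gives it at infinity. -/
theorem lintegral_vertical_le {s : ℝ} (hs : 0 < s) (hsα : s < α + 1) {y : ℝ} (hy : 0 < y) :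
    ∫⁻ v in Ioi (0 : ℝ), ENNReal.ofReal (v ^ α * v ^ (-s) * (y + v) ^ (-α - 1)) ≤
      ENNReal.ofReal ((1 / (α - s + 1) + 1 / s) * y ^ (-s)) := by
  have hα : 0 < α + 1 := by linarith
  rw [← Ioc_union_Ioi_eq_Ioi hy.le, add_mul, ENNReal.ofReal_add (mul_nonneg (one_div_nonneg.2
    (by linarith)) (by positivity)) (by positivity)]
  refine (lintegral_union_le _ _ _).trans (add_le_add ?_ ?_)
  · have hi : IntegrableOn (fun v : ℝ => y ^ (-α - 1) * v ^ (α - s)) (Ioc 0 y) :=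
      ((intervalIntegrable_iff_integrableOn_Ioc_of_le hy.le).1
        (intervalIntegral.intervalIntegrable_rpow' (by linarith))).const_mul _
    calc _ ≤ ∫⁻ v in Ioc 0 y, ENNReal.ofReal (y ^ (-α - 1) * v ^ (α - s)) := by
          refine setLIntegral_mono' measurableSet_Ioc fun v hv => ENNReal.ofReal_le_ofReal ?_
          rw [← Real.rpow_add hv.1, mul_comm, ← sub_eq_add_neg]
          have := hv.1
          exact mul_le_mul_of_nonneg_right
            (Real.rpow_le_rpow_of_nonpos hy (by linarith) (by linarith)) (by positivity)
      _ = ENNReal.ofReal (∫ v in Ioc 0 y, y ^ (-α - 1) * v ^ (α - s)) := by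
          refine (ofReal_integral_eq_lintegral_ofReal hi ?_).symm
          filter_upwards [ae_restrict_mem measurableSet_Ioc] with v hv
          have := hv.1
          positivity
      _ ≤ _ := by
          refine ENNReal.ofReal_le_ofReal (le_of_eq ?_)
          rw [integral_const_mul, ← intervalIntegral.integral_of_le hy.le,
            integral_rpow (Or.inl (by linarith)), Real.zero_rpow (by linarith), sub_zero,
            mul_div_assoc', ← Real.rpow_add hy, div_mul_eq_mul_div, one_mul]
          ring_nf
  · have hi : IntegrableOn (fun v : ℝ => v ^ (-1 - s)) (Ioi y) :=
      integrableOn_Ioi_rpow_of_lt (by linarith) hy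
    calc _ ≤ ∫⁻ v in Ioi y, ENNReal.ofReal (v ^ (-1 - s)) := by
          refine setLIntegral_mono' measurableSet_Ioi fun v hv => ENNReal.ofReal_le_ofReal ?_
          have hv0 : 0 < v := hy.trans hv
          calc v ^ α * v ^ (-s) * (y + v) ^ (-α - 1)
              ≤ v ^ α * v ^ (-s) * v ^ (-α - 1) := mul_le_mul_of_nonneg_left
                (Real.rpow_le_rpow_of_nonpos hv0 (by linarith) (by linarith)) (by positivity)
            _ = v ^ (-1 - s) := by
                rw [← Real.rpow_add hv0, ← Real.rpow_add hv0]; ring_nf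
      _ = ENNReal.ofReal (∫ v in Ioi y, v ^ (-1 - s)) := by
          refine (ofReal_integral_eq_lintegral_ofReal hi ?_).symm
          filter_upwards [ae_restrict_mem measurableSet_Ioi] with v hv
          have := hy.trans hv
          positivity
      _ ≤ _ := by
          refine ENNReal.ofReal_le_ofReal (le_of_eq ?_)
          rw [integral_Ioi_rpow_of_lt (by linarith) hy]
          have : -1 - s + 1 = -s := by ring
          rw [this]
          field_simp

/-- The Forelli–Rudin type estimate for the modulus of the Bergman kernel. -/
theorem exists_lintegral_kernel_le {s : ℝ} (hs : 0 < s) (hsα : s < α + 1) :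
    ∃ C : ℝ, 0 < C ∧ ∀ z ∈ upperPlane,
      ∫⁻ w, ENNReal.ofReal (‖kernel α z w‖ * w.im ^ (-s)) ∂(V α) ≤
        ENNReal.ofReal (C * z.im ^ (-s)) := by
  obtain ⟨B, hB, hB'⟩ := exists_lintegral_kernel_horizontal_le (α := α) (by linarith)
  have h1 : 0 < 1 / (α - s + 1) := one_div_pos.2 (by linarith)
  refine ⟨B * (1 / (α - s + 1) + 1 / s), by positivity, fun z hz => ?_⟩
  have hzi : 0 < z.im := hz
  have hkm : Measurable fun w => kernel α z w :=
    (measurable_kernel α).comp measurable_prodMk_left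
  rw [lintegral_V α (by fun_prop)]
  calc _ ≤ ∫⁻ v in Ioi (0 : ℝ), ENNReal.ofReal B *
        ENNReal.ofReal (v ^ α * v ^ (-s) * (z.im + v) ^ (-α - 1)) := by
        refine setLIntegral_mono' measurableSet_Ioi fun v hv => ?_
        have hv0 : 0 < v := hv
        calc _ = ∫⁻ u : ℝ, ENNReal.ofReal (v ^ α * v ^ (-s)) *
              ENNReal.ofReal ‖kernel α z ⟨u, v⟩‖ := by
              refine lintegral_congr fun u => ?_
              rw [← ENNReal.ofReal_mul (by positivity), ← ENNReal.ofReal_mul (by positivity)]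
              ring_nf
          _ = ENNReal.ofReal (v ^ α * v ^ (-s)) * ∫⁻ u : ℝ, ENNReal.ofReal ‖kernel α z ⟨u, v⟩‖ :=
              lintegral_const_mul' _ _ ENNReal.ofReal_ne_top
          _ ≤ ENNReal.ofReal (v ^ α * v ^ (-s)) * ENNReal.ofReal (B * (z.im + v) ^ (-α - 1)) := by
              gcongr
              exact hB' z hzi v hv0
          _ = _ := by
              rw [← ENNReal.ofReal_mul (by positivity), ← ENNReal.ofReal_mul (by positivity)]
              ring_nf
    _ = ENNReal.ofReal B *
        ∫⁻ v in Ioi (0 : ℝ), ENNReal.ofReal (v ^ α * v ^ (-s) * (z.im + v) ^ (-α - 1)) :=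
        lintegral_const_mul' _ _ ENNReal.ofReal_ne_top
    _ ≤ ENNReal.ofReal B * ENNReal.ofReal ((1 / (α - s + 1) + 1 / s) * z.im ^ (-s)) := by
        gcongr
        exact lintegral_vertical_le hs hsα hzi
    _ = _ := by rw [← ENNReal.ofReal_mul hB.le, mul_assoc]

theorem integrable_of_lintegral_ofReal_le {X : Type*} [MeasurableSpace X] {μ : Measure X}
    {f : X → ℝ} {c : ℝ} (hc : 0 ≤ c) (hf : AEStronglyMeasurable f μ) (h0 : ∀ᵐ x ∂μ, 0 ≤ f x)
    (h : ∫⁻ x, ENNReal.ofReal (f x) ∂μ ≤ ENNReal.ofReal c) :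
    Integrable f μ ∧ ∫ x, f x ∂μ ≤ c := by
  refine ⟨⟨hf, ?_⟩, ?_⟩
  · rw [hasFiniteIntegral_iff_ofReal h0]
    exact h.trans_lt ENNReal.ofReal_lt_top
  · rw [integral_eq_lintegral_of_nonneg_ae h0 hf]
    exact ENNReal.toReal_le_of_le_ofReal hc h

/-- For fixed `z` the bound is uniform in `w`; hence the Schur kernel times `Φ ∘ f` is integrable
for every `z`, not merely almost every one. -/
theorem kernel_mul_rpow_le {b : ℝ} (hb : 0 ≤ b) (hbα : b ≤ α + 2) {z w : ℂ}
    (hz : z ∈ upperPlane) (hw : w ∈ upperPlane) :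
    ‖kernel α z w‖ * (w.im / z.im) ^ b ≤ z.im ^ (-α - 2) := by
  have hz0 : 0 < z.im := hz
  have hw0 : 0 < w.im := hw
  have hY : 0 < z.im + w.im := by positivity
  have h1 : ‖kernel α z w‖ ≤ (z.im + w.im) ^ (-α - 2) := by
    rw [norm_kernel]
    exact Real.rpow_le_rpow_of_nonpos hY (im_add_im_le_norm_sub_conj z w) (by linarith)
  calc ‖kernel α z w‖ * (w.im / z.im) ^ b
      ≤ (z.im + w.im) ^ (-α - 2) * ((z.im + w.im) / z.im) ^ b := by
        gcongr
        linarith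
    _ = (z.im + w.im) ^ (b - α - 2) * z.im ^ (-b) := by
        rw [Real.div_rpow hY.le hz0.le, Real.rpow_neg hz0.le, ← div_eq_mul_inv, mul_div_assoc',
          ← Real.rpow_add hY]
        ring_nf
    _ ≤ z.im ^ (b - α - 2) * z.im ^ (-b) := mul_le_mul_of_nonneg_right
        (Real.rpow_le_rpow_of_nonpos hz0 (by linarith) (by linarith)) (by positivity)
    _ = z.im ^ (-α - 2) := by rw [← Real.rpow_add hz0]; ring_nf

theorem exists_lintegral_kernel_ratio_le {b : ℝ} (hb : 0 < b) (hbα : b < α + 1) :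
    ∃ C : ℝ, 0 < C ∧ ∀ z ∈ upperPlane,
      ∫⁻ w, ENNReal.ofReal (‖kernel α z w‖ * (w.im / z.im) ^ (-b)) ∂(V α) ≤
        ENNReal.ofReal C := by
  obtain ⟨C, hC, h⟩ := exists_lintegral_kernel_le hb hbα
  refine ⟨C, hC, fun z hz => ?_⟩
  have hz0 : 0 < z.im := hz
  calc _ = ∫⁻ w, ENNReal.ofReal (z.im ^ b) *
        ENNReal.ofReal (‖kernel α z w‖ * w.im ^ (-b)) ∂(V α) := by
        refine lintegral_congr_ae ?_
        filter_upwards [ae_mem_upperPlane α] with w hw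
        have hw0 : 0 < w.im := hw
        rw [← ENNReal.ofReal_mul (by positivity), Real.div_rpow hw0.le hz0.le,
          Real.rpow_neg hz0.le b, div_inv_eq_mul]
        ring_nf
    _ = ENNReal.ofReal (z.im ^ b) *
        ∫⁻ w, ENNReal.ofReal (‖kernel α z w‖ * w.im ^ (-b)) ∂(V α) :=
        lintegral_const_mul' _ _ ENNReal.ofReal_ne_top
    _ ≤ ENNReal.ofReal (z.im ^ b) * ENNReal.ofReal (C * z.im ^ (-b)) := by
        gcongr
        exact h z hz
    _ = ENNReal.ofReal C := by
        rw [← ENNReal.ofReal_mul (by positivity), Real.rpow_neg hz0.le]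
        field_simp

/-! ### The Schur test in Orlicz spaces. -/

/-- The sum of kernels that dominates the positive Bergman operator in the modular of `L^Φ`. -/
noncomputable def schurKernel (α b d : ℝ) (z w : ℂ) : ℝ :=
  ‖kernel α z w‖ * ((w.im / z.im) ^ b + (w.im / z.im) ^ d)

theorem measurable_schurKernel (α b d : ℝ) : Measurable (Function.uncurry (schurKernel α b d)) := by
  have := measurable_kernel α
  unfold schurKernel
  unfold Function.uncurry at *
  fun_prop

theorem schurKernel_nonneg {b d : ℝ} {z w : ℂ} (hz : z ∈ upperPlane) (hw : w ∈ upperPlane) :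
    0 ≤ schurKernel α b d z w := by
  have hz0 : 0 < z.im := hz
  have hw0 : 0 < w.im := hw
  unfold schurKernel
  positivity

theorem exists_lintegral_schurKernel_le {b d : ℝ} (hb : 0 < b) (hbα : b < α + 1) (hd : 0 < d)
    (hdα : d < α + 1) :
    ∃ C : ℝ, 0 < C ∧ ∀ w ∈ upperPlane,
      ∫⁻ z, ENNReal.ofReal (schurKernel α b d z w) ∂(V α) ≤ ENNReal.ofReal C := by
  obtain ⟨B, hB, h⟩ := exists_lintegral_kernel_ratio_le hb hbα
  obtain ⟨D, hD, h'⟩ := exists_lintegral_kernel_ratio_le hd hdα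
  refine ⟨B + D, by positivity, fun w hw => ?_⟩
  have hw0 : 0 < w.im := hw
  have hm : Measurable fun z => kernel α w z := (measurable_kernel α).of_uncurry_left
  -- The modulus of the kernel is symmetric, so integration in `z` reduces to the estimate in `w`
  -- with the ratio inverted.
  calc _ = ∫⁻ z, ENNReal.ofReal (‖kernel α w z‖ * (z.im / w.im) ^ (-b)) +
        ENNReal.ofReal (‖kernel α w z‖ * (z.im / w.im) ^ (-d)) ∂(V α) := by
        refine lintegral_congr_ae ?_
        filter_upwards [ae_mem_upperPlane α] with z hz
        have hz0 : 0 < z.im := hz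
        have key : ∀ e : ℝ, (z.im / w.im) ^ (-e) = (w.im / z.im) ^ e := fun e => by
          rw [Real.rpow_neg (by positivity), ← Real.inv_rpow (by positivity), inv_div]
        rw [← ENNReal.ofReal_add (by positivity) (by positivity), key, key, schurKernel,
          norm_kernel_comm, mul_add]
    _ = _ := lintegral_add_left (by fun_prop) _
    _ ≤ _ := by
        rw [ENNReal.ofReal_add hB.le hD.le]
        exact add_le_add (h w hw) (h' w hw)

/-- The pointwise half of the Schur test in Orlicz spaces. -/
theorem ClassU.map_integral_kernel_le (hΦ : ClassU Φ) {p q C s c : ℝ} (hp : 1 ≤ p) (hq : 1 ≤ q)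
    (hdil : ∀ r, 0 < r → ∀ t, 0 ≤ t → Φ (t * r) ≤ C * (r ^ p + r ^ q) * Φ t)
    (hs : 0 < s) (hsp : s * (p - 1) ≤ α + 2) (hsq : s * (q - 1) ≤ α + 2) (hc : 0 < c) (hC : 0 < C)
    {z : ℂ} (hz : z ∈ upperPlane)
    (hcz : ∫⁻ w, ENNReal.ofReal (‖kernel α z w‖ * (w.im / z.im) ^ (-s)) ∂(V α) ≤
      ENNReal.ofReal c)
    {f : ℂ → ℝ} (hf : AEMeasurable f (V α)) (hf0 : ∀ w, 0 ≤ f w)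
    (hfi : Integrable (fun w => Φ (f w)) (V α)) :
    Integrable (fun w => ‖kernel α z w‖ * f w) (V α) ∧
    ENNReal.ofReal (Φ (c⁻¹ * ∫ w, ‖kernel α z w‖ * f w ∂(V α))) ≤ ENNReal.ofReal (c⁻¹ * C) *
      ∫⁻ w, ENNReal.ofReal (schurKernel α (s * (p - 1)) (s * (q - 1)) z w) *
        ENNReal.ofReal (Φ (f w)) ∂(V α) := by
  have hz0 : 0 < z.im := hz
  have hkm : Measurable fun w => kernel α z w := (measurable_kernel α).of_uncurry_left
  set M := schurKernel α (s * (p - 1)) (s * (q - 1)) z with hM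
  have hMm : Measurable M := (measurable_schurKernel α _ _).of_uncurry_left
  -- On the half-plane `k * t` is `‖kernel α z w‖ * f w`: `k` is the Jensen weight and `t` carries
  -- the compensating power.
  set k : ℂ → ℝ := fun w => ‖kernel α z w‖ * (w.im / z.im) ^ (-s) with hk
  set t : ℂ → ℝ := fun w => f w * (w.im / z.im) ^ s with ht
  have hkme : Measurable k := by fun_prop
  have htm : AEMeasurable t (V α) := by
    have : Measurable fun w : ℂ => (w.im / z.im) ^ s := by fun_prop
    exact hf.mul this.aemeasurable
  have hk0 : ∀ᵐ w ∂(V α), 0 ≤ k w := by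
    filter_upwards [ae_mem_upperPlane α] with w hw
    have hw0 : 0 < w.im := hw
    positivity
  have ht0 : ∀ᵐ w ∂(V α), 0 ≤ t w := by
    filter_upwards [ae_mem_upperPlane α] with w hw
    have hw0 : 0 < w.im := hw
    exact mul_nonneg (hf0 w) (by positivity)
  have hΦt : AEMeasurable (fun w => Φ (t w)) (V α) := by
    -- `Φ` is controlled only on `[0, ∞)`; composing with the absolute value gives a function
    -- continuous on all of `ℝ`.
    refine ((hΦ.continuous_comp continuous_abs abs_nonneg).measurable.comp_aemeasurable
      htm).congr ?_
    filter_upwards [ht0] with w hw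
    simp [abs_of_nonneg hw]
  obtain ⟨hki, hkc⟩ := integrable_of_lintegral_ofReal_le hc.le hkme.aestronglyMeasurable hk0 hcz
  have hMi : Integrable (fun w => M w * Φ (f w)) (V α) := by
    refine hfi.bdd_mul (c := z.im ^ (-α - 2) + z.im ^ (-α - 2)) hMm.aestronglyMeasurable ?_
    filter_upwards [ae_mem_upperPlane α] with w hw
    rw [Real.norm_of_nonneg (schurKernel_nonneg hz hw), schurKernel, mul_add]
    exact add_le_add (kernel_mul_rpow_le (mul_nonneg hs.le (by linarith)) hsp hz hw)
      (kernel_mul_rpow_le (mul_nonneg hs.le (by linarith)) hsq hz hw)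
  have hle : ∀ᵐ w ∂(V α), k w * Φ (t w) ≤ C * (M w * Φ (f w)) := by
    filter_upwards [ae_mem_upperPlane α, hk0] with w hw hkw
    have hw0 : 0 < w.im := hw
    set r := w.im / z.im with hr
    have hr0 : 0 < r := by positivity
    calc k w * Φ (t w) ≤ k w * (C * ((r ^ s) ^ p + (r ^ s) ^ q) * Φ (f w)) :=
          mul_le_mul_of_nonneg_left (hdil _ (by positivity) _ (hf0 w)) hkw
      _ = C * (‖kernel α z w‖ * (r ^ (-s) * (r ^ s) ^ p + r ^ (-s) * (r ^ s) ^ q) * Φ (f w)) := by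
          simp only [hk]; ring
      _ = C * (M w * Φ (f w)) := by
          rw [← Real.rpow_mul hr0.le, ← Real.rpow_mul hr0.le, ← Real.rpow_add hr0,
            ← Real.rpow_add hr0, hM, schurKernel, ← hr]
          ring_nf
  have hkΦ : Integrable (fun w => k w * Φ (t w)) (V α) := by
    refine (hMi.const_mul C).mono' (hkme.aemeasurable.mul hΦt).aestronglyMeasurable ?_
    filter_upwards [hle, hk0, ht0] with w h1 h2 h3
    rwa [Real.norm_of_nonneg (mul_nonneg h2 (hΦ.growth.nonneg h3))]
  have hkt : Integrable (fun w => k w * t w) (V α) := by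
    -- Since `t ≤ 1 + Φ t / Φ 1`, integrability of `k` and of `k * Φ ∘ t` gives that of `k * t`.
    refine (hki.add (hkΦ.const_mul (Φ 1)⁻¹)).mono'
      (hkme.aemeasurable.mul htm).aestronglyMeasurable ?_
    filter_upwards [hk0, ht0] with w h2 h3
    rw [Real.norm_of_nonneg (mul_nonneg h2 h3)]
    calc k w * t w ≤ k w * (1 + Φ (t w) / Φ 1) := by
          gcongr
          exact hΦ.le_one_add_div h3
      _ = _ := by simp only [Pi.add_apply]; ring
  have heq : (fun w => k w * t w) =ᵐ[V α] fun w => ‖kernel α z w‖ * f w := by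
    filter_upwards [ae_mem_upperPlane α] with w hw
    have hw0 : 0 < w.im := hw
    simp only [hk, ht]
    rw [Real.rpow_neg (by positivity)]
    have : 0 < (w.im / z.im) ^ s := by positivity
    field_simp
  refine ⟨hkt.congr heq, ?_⟩
  have hJ := hΦ.map_integral_le hc hk0 ht0 hki hkc hkt hkΦ
  rw [integral_congr_ae heq] at hJ
  have hJ2 : Φ (c⁻¹ * ∫ w, ‖kernel α z w‖ * f w ∂(V α)) ≤
      c⁻¹ * C * ∫ w, M w * Φ (f w) ∂(V α) := by
    refine hJ.trans ?_
    rw [mul_assoc, ← integral_const_mul C]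
    exact mul_le_mul_of_nonneg_left (integral_mono_ae hkΦ (hMi.const_mul C) hle) (by positivity)
  refine (ENNReal.ofReal_le_ofReal hJ2).trans ?_
  rw [ENNReal.ofReal_mul (by positivity), ofReal_integral_eq_lintegral_ofReal hMi]
  · refine (congrArg _ (lintegral_congr_ae ?_)).le
    filter_upwards [ae_mem_upperPlane α] with w hw
    rw [ENNReal.ofReal_mul (schurKernel_nonneg hz hw)]
  · filter_upwards [ae_mem_upperPlane α] with w hw
    exact mul_nonneg (schurKernel_nonneg hz hw) (hΦ.growth.nonneg (hf0 w))

/-- The modular inequality for the positive Bergman operator. -/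
theorem ClassU.exists_modular_le (hα : -1 < α) (hΦ : ClassU Φ) (hΦ₂ : Nabla2 Φ) :
    ∃ c N : ℝ, 0 < c ∧ 0 < N ∧ ∀ f : ℂ → ℝ, AEMeasurable f (V α) → (∀ w, 0 ≤ f w) →
      ∫⁻ w, ENNReal.ofReal (Φ (f w)) ∂(V α) ≤ 1 →
      (∀ z ∈ upperPlane, Integrable (fun w => ‖kernel α z w‖ * f w) (V α)) ∧
      ∫⁻ z, ENNReal.ofReal (Φ (c⁻¹ * ∫ w, ‖kernel α z w‖ * f w ∂(V α))) ∂(V α) ≤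
        ENNReal.ofReal N := by
  obtain ⟨p, q, C, hp, hq, hC, hdil⟩ := hΦ.exists_dilation_bound hΦ₂
  -- As `p, q > 1`, this puts `s`, `s * (p - 1)` and `s * (q - 1)` all strictly between `0` and `α +
  -- 1`, the range of the kernel estimates.
  set s := (α + 1) / (p + q) with hs
  have hα1 : 0 < α + 1 := by linarith
  have hs0 : 0 < s := by positivity
  have hsm : s * (p + q) = α + 1 := by rw [hs]; field_simp
  have hsα : s < α + 1 := by nlinarith
  have hsp : s * (p - 1) < α + 1 := by nlinarith
  have hsq : s * (q - 1) < α + 1 := by nlinarith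
  obtain ⟨c, hc, hcz⟩ := exists_lintegral_kernel_ratio_le hs0 hsα
  obtain ⟨B, hB, hBw⟩ := exists_lintegral_schurKernel_le (α := α)
    (mul_pos hs0 (sub_pos.2 hp)) hsp (mul_pos hs0 (sub_pos.2 hq)) hsq
  refine ⟨c, c⁻¹ * C * B, hc, by positivity, fun f hf hf0 hf1 => ?_⟩
  have hΦf : AEMeasurable (fun w => Φ (f w)) (V α) := by
    refine ((hΦ.continuous_comp continuous_abs abs_nonneg).measurable.comp_aemeasurable
      hf).congr (ae_of_all _ fun w => ?_)
    simp [abs_of_nonneg (hf0 w)]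
  have hfi : Integrable (fun w => Φ (f w)) (V α) :=
    (integrable_of_lintegral_ofReal_le zero_le_one hΦf.aestronglyMeasurable
      (ae_of_all _ fun w => hΦ.growth.nonneg (hf0 w)) (by simpa using hf1)).1
  have main := fun z (hz : z ∈ upperPlane) => hΦ.map_integral_kernel_le hp.le hq.le hdil hs0
    (by linarith) (by linarith) hc hC hz (hcz z hz) hf hf0 hfi
  refine ⟨fun z hz => (main z hz).1, ?_⟩
  set M := schurKernel α (s * (p - 1)) (s * (q - 1)) with hM
  calc _ ≤ ∫⁻ z, ENNReal.ofReal (c⁻¹ * C) *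
        ∫⁻ w, ENNReal.ofReal (M z w) * ENNReal.ofReal (Φ (f w)) ∂(V α) ∂(V α) := by
        refine lintegral_mono_ae ?_
        filter_upwards [ae_mem_upperPlane α] with z hz using (main z hz).2
    _ = ENNReal.ofReal (c⁻¹ * C) *
        ∫⁻ w, ∫⁻ z, ENNReal.ofReal (M z w) * ENNReal.ofReal (Φ (f w)) ∂(V α) ∂(V α) := by
        rw [lintegral_const_mul' _ _ ENNReal.ofReal_ne_top, lintegral_lintegral_swap]
        exact (measurable_schurKernel α _ _).ennreal_ofReal.aemeasurable.mul
          hΦf.ennreal_ofReal.comp_snd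
    _ = ENNReal.ofReal (c⁻¹ * C) *
        ∫⁻ w, (∫⁻ z, ENNReal.ofReal (M z w) ∂(V α)) * ENNReal.ofReal (Φ (f w)) ∂(V α) := by
        congr 1
        refine lintegral_congr fun w => lintegral_mul_const' _ _ ENNReal.ofReal_ne_top
    _ ≤ ENNReal.ofReal (c⁻¹ * C) *
        ∫⁻ w, ENNReal.ofReal B * ENNReal.ofReal (Φ (f w)) ∂(V α) := by
        refine mul_le_mul_right (lintegral_mono_ae ?_) _
        filter_upwards [ae_mem_upperPlane α] with w hw
        gcongr
        exact hBw w hw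
    _ ≤ ENNReal.ofReal (c⁻¹ * C) * (ENNReal.ofReal B * 1) := by
        rw [lintegral_const_mul' _ _ ENNReal.ofReal_ne_top]
        gcongr
    _ = _ := by rw [mul_one, ← ENNReal.ofReal_mul (by positivity)]

/-- Boundedness, in the Luxemburg norm, of every operator dominated by the positive Bergman
operator. -/
theorem ClassU.exists_luxNorm_le (hα : -1 < α) (hΦ : ClassU Φ) (hΦ₂ : Nabla2 Φ) :
    ∃ D : ℝ≥0, ∀ F : ℂ → ℂ, MemOrlicz Φ (V α) F →
      (∀ z ∈ upperPlane, Integrable (fun w => ‖kernel α z w‖ * ‖F w‖) (V α)) ∧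
      ∀ H : ℂ → ℂ, (∀ z ∈ upperPlane, ‖H z‖ ≤ ∫ w, ‖kernel α z w‖ * ‖F w‖ ∂(V α)) →
        luxNorm Φ (V α) H ≤ D * luxNorm Φ (V α) F := by
  obtain ⟨c, N, hc, hN, hmod⟩ := hΦ.exists_modular_le hα hΦ₂
  -- Convexity gives `Φ (x / B) ≤ Φ x / B`, so a further division by `B` brings the modular from at
  -- most `N` to at most `1`.
  set B := max 1 N with hB
  have hB1 : 1 ≤ B := le_max_left _ _
  have hB0 : 0 < B := by linarith
  have hcB : 0 < c * B := by positivity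
  have step : ∀ F : ℂ → ℂ, AEStronglyMeasurable F (V α) → ∀ l : ℝ, 0 < l →
      ∫⁻ w, ENNReal.ofReal (Φ (‖F w‖ / l)) ∂(V α) ≤ 1 →
      (∀ z ∈ upperPlane, Integrable (fun w => ‖kernel α z w‖ * ‖F w‖) (V α)) ∧
      ∀ H : ℂ → ℂ, (∀ z ∈ upperPlane, ‖H z‖ ≤ ∫ w, ‖kernel α z w‖ * ‖F w‖ ∂(V α)) →
        luxNorm Φ (V α) H ≤ ENNReal.ofReal (c * B) * ENNReal.ofReal l := by
    intro F hF l hl hle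
    obtain ⟨hint, hlint⟩ := hmod (fun w => ‖F w‖ / l) (hF.norm.aemeasurable.div_const l)
      (fun w => by positivity) hle
    have hcongr : ∀ z, (fun w => ‖kernel α z w‖ * (‖F w‖ / l)) =
        fun w => l⁻¹ * (‖kernel α z w‖ * ‖F w‖) := fun z => by ext w; ring
    refine ⟨fun z hz => ?_, fun H hH => ?_⟩
    · have := (hint z hz).const_mul l
      refine this.congr (ae_of_all _ fun w => ?_)
      dsimp only
      field_simp
    · rw [← ENNReal.ofReal_mul hcB.le]
      refine iInf₂_le_of_le (c * B * l) (by positivity) (iInf_le_of_le ?_ le_rfl)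
      calc ∫⁻ z, ENNReal.ofReal (Φ (‖H z‖ / (c * B * l))) ∂(V α)
          ≤ ∫⁻ z, (ENNReal.ofReal B)⁻¹ * ENNReal.ofReal (Φ (c⁻¹ *
              ∫ w, ‖kernel α z w‖ * (‖F w‖ / l) ∂(V α))) ∂(V α) := by
            refine lintegral_mono_ae ?_
            filter_upwards [ae_mem_upperPlane α] with z hz
            rw [← ENNReal.ofReal_inv_of_pos hB0, ← ENNReal.ofReal_mul (by positivity), hcongr,
              integral_const_mul]
            refine ENNReal.ofReal_le_ofReal ?_
            have hI : 0 ≤ ∫ w, ‖kernel α z w‖ * ‖F w‖ ∂(V α) :=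
              integral_nonneg fun w => by positivity
            rw [← div_eq_inv_mul]
            refine le_trans ?_ (hΦ.map_div_le hB1 (by positivity))
            refine hΦ.growth.monotoneOn (mem_Ici.2 (by positivity)) (mem_Ici.2 (by positivity)) ?_
            rw [div_le_iff₀ (by positivity)]
            refine (hH z hz).trans (le_of_eq ?_)
            field_simp
        _ = (ENNReal.ofReal B)⁻¹ * ∫⁻ z, ENNReal.ofReal (Φ (c⁻¹ *
              ∫ w, ‖kernel α z w‖ * (‖F w‖ / l) ∂(V α))) ∂(V α) :=
            lintegral_const_mul' _ _ (ENNReal.inv_ne_top.2 (by simpa using hB0))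
        _ ≤ (ENNReal.ofReal B)⁻¹ * ENNReal.ofReal B := by
            gcongr
            exact hlint.trans (ENNReal.ofReal_le_ofReal (le_max_right _ _))
        _ = 1 := ENNReal.inv_mul_cancel (by simpa using hB0) ENNReal.ofReal_ne_top
  refine ⟨(c * B).toNNReal, fun F hF => ⟨?_, fun H hH => ?_⟩⟩
  · have hlt := hF.2
    simp only [luxNorm, iInf_lt_iff] at hlt
    obtain ⟨l, hl, hle, -⟩ := hlt
    exact (step F hF.1 l hl hle).1
  · change _ ≤ ENNReal.ofReal (c * B) * _
    have h0 : ENNReal.ofReal (c * B) ≠ 0 := by simpa using hcB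
    rw [mul_comm _ (luxNorm Φ (V α) F),
      ← ENNReal.div_le_iff_le_mul (Or.inl h0) (Or.inl ENNReal.ofReal_ne_top)]
    refine le_iInf fun l => le_iInf fun hl => le_iInf fun hle => ?_
    rw [ENNReal.div_le_iff_le_mul (Or.inl h0) (Or.inl ENNReal.ofReal_ne_top), mul_comm]
    exact (step F hF.1 l hl hle).2 H hH

/-! ### Analyticity, measurability and integrability. -/

theorem sub_conj_div_I_mem_slitPlane {z w : ℂ} (hz : z ∈ upperPlane) (hw : w ∈ upperPlane) :
    (z - conj w) / Complex.I ∈ Complex.slitPlane := by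
  have hz0 : 0 < z.im := hz
  have hw0 : 0 < w.im := hw
  left
  simp only [Complex.div_I, Complex.neg_re, Complex.mul_re, Complex.sub_re, Complex.I_re,
    Complex.sub_im, Complex.conj_im, Complex.I_im]
  linarith

theorem hasDerivAt_kernel (α : ℝ) {z w : ℂ} (hz : z ∈ upperPlane) (hw : w ∈ upperPlane) :
    HasDerivAt (fun z => kernel α z w)
      (((-α - 2 : ℝ) : ℂ) * ((z - conj w) / Complex.I) ^ (((-α - 2 : ℝ) : ℂ) - 1) *
        (1 / Complex.I)) z :=
  (((hasDerivAt_id z).sub_const _).div_const _).cpow_const (sub_conj_div_I_mem_slitPlane hz hw)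

/-- For `z` within `z₀.im / 2` of `z₀`, `|z - w̄|` is at least half of `d = |z₀ - w̄|`. The
derivative has one extra power of `1 / d`, absorbed by `d ≥ z₀.im`, so a multiple of the integrand
at `z₀` dominates. -/
theorem differentiableOn_bergmanProj (hα : -1 < α) {F : ℂ → ℂ}
    (hF : AEStronglyMeasurable F (V α))
    (hint : ∀ z ∈ upperPlane, Integrable (fun w => kernel α z w * F w) (V α)) :
    DifferentiableOn ℂ (bergmanProj α F) upperPlane := by
  intro z₀ hz₀
  have hy : 0 < z₀.im := hz₀
  refine DifferentiableAt.differentiableWithinAt ?_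
  set F' : ℂ → ℂ → ℂ := fun z w => (((-α - 2 : ℝ) : ℂ) *
    ((z - conj w) / Complex.I) ^ (((-α - 2 : ℝ) : ℂ) - 1) * (1 / Complex.I)) * F w with hF'
  have hball : ∀ z ∈ Metric.ball z₀ (z₀.im / 2), z ∈ upperPlane := fun z hz => by
    have h1 := (abs_le.1 (Complex.abs_im_le_norm (z - z₀))).1
    rw [Metric.mem_ball, dist_eq_norm] at hz
    rw [Complex.sub_im] at h1
    change 0 < z.im
    linarith
  have hkm : ∀ z, Measurable fun w => kernel α z w :=
    fun z => (measurable_kernel α).of_uncurry_left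
  refine (hasDerivAt_integral_of_dominated_loc_of_deriv_le (F' := F')
    (bound := fun w => ((α + 2) * 2 ^ (α + 3) / z₀.im) * ‖kernel α z₀ w * F w‖)
    (Metric.ball_mem_nhds z₀ (half_pos hy)) (Eventually.of_forall fun z =>
      (hkm z).aestronglyMeasurable.mul hF) (hint z₀ hz₀) ?_ ?_ ((hint z₀ hz₀).norm.const_mul _)
    ?_).2.differentiableAt
  · refine AEStronglyMeasurable.mul ?_ hF
    exact (by fun_prop : Measurable _).aestronglyMeasurable
  · filter_upwards [ae_mem_upperPlane α] with w hw z hz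
    have hw0 : 0 < w.im := hw
    set d := ‖z₀ - conj w‖ with hd
    have hd0 : z₀.im ≤ d := by
      have := im_add_im_le_norm_sub_conj z₀ w
      linarith
    have hdpos : 0 < d := hy.trans_le hd0
    have hd2 : d / 2 ≤ ‖z - conj w‖ := by
      have h1 : d ≤ ‖z₀ - z‖ + ‖z - conj w‖ := by
        rw [hd]
        refine le_trans (le_of_eq ?_) (norm_add_le _ _)
        congr 1
        ring
      rw [Metric.mem_ball, dist_comm, dist_eq_norm] at hz
      linarith
    have hexp : (((-α - 2 : ℝ) : ℂ) - 1) = ((-(α + 3) : ℝ) : ℂ) := by push_cast; ring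
    rw [hF', norm_mul, norm_mul, norm_mul, hexp, Complex.norm_cpow_real, norm_div, norm_div,
      Complex.norm_I, norm_one, div_one, div_one, mul_one, Complex.norm_real, Real.norm_eq_abs,
      abs_of_neg (by linarith), norm_mul, ← mul_assoc, norm_kernel]
    refine mul_le_mul_of_nonneg_right ?_ (norm_nonneg _)
    calc -(-α - 2) * ‖z - conj w‖ ^ (-(α + 3)) ≤ (α + 2) * (d / 2) ^ (-(α + 3)) := by
          rw [show -(-α - 2) = α + 2 by ring]
          exact mul_le_mul_of_nonneg_left
            (Real.rpow_le_rpow_of_nonpos (by positivity) hd2 (by linarith)) (by linarith)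
      _ = (α + 2) * 2 ^ (α + 3) / d * d ^ (-α - 2) := by
          have : d ^ (-(α + 3)) = d ^ (-α - 2) / d := by
            rw [← Real.rpow_sub_one hdpos.ne']; ring_nf
          rw [Real.div_rpow hdpos.le two_pos.le, Real.rpow_neg two_pos.le, this]
          field_simp
      _ ≤ _ := by
          have : 0 ≤ α + 2 := by linarith
          gcongr
  · filter_upwards [ae_mem_upperPlane α] with w hw z hz
    exact (hasDerivAt_kernel α (hball z hz) hw).mul_const (F w)

/-- Passing to a strongly measurable representative of `F` leaves the integral unchanged at every
`z` and makes the integrand jointly measurable. -/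
theorem aestronglyMeasurable_bergmanPos {F : ℂ → ℂ} (hF : AEStronglyMeasurable F (V α)) :
    AEStronglyMeasurable (bergmanPos α F) (V α) := by
  have heq : bergmanPos α F = fun z => ∫ w, (‖kernel α z w‖ : ℂ) * hF.mk F w ∂(V α) := by
    ext z
    refine integral_congr_ae ?_
    filter_upwards [hF.ae_eq_mk] with w hw
    rw [hw]
  rw [heq]
  refine (StronglyMeasurable.integral_prod_right ?_).aestronglyMeasurable
  exact (Complex.measurable_ofReal.comp (measurable_kernel α).norm).stronglyMeasurable.mul
    (hF.stronglyMeasurable_mk.comp_measurable measurable_snd)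

theorem aestronglyMeasurable_of_differentiableOn {F : ℂ → ℂ}
    (hF : DifferentiableOn ℂ F upperPlane) : AEStronglyMeasurable F (V α) :=
  (hF.continuousOn.aestronglyMeasurable measurableSet_upperPlane).mono_ac
    (withDensity_absolutelyContinuous _ _)

theorem integrable_kernel_mul {F : ℂ → ℂ} (hF : AEStronglyMeasurable F (V α)) {z : ℂ}
    (h : Integrable (fun w => ‖kernel α z w‖ * ‖F w‖) (V α)) :
    Integrable (fun w => kernel α z w * F w) (V α) :=
  h.mono ((measurable_kernel α).of_uncurry_left.aestronglyMeasurable.mul hF)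
    (ae_of_all _ fun w => by simp)

theorem integrable_norm_kernel_mul {F : ℂ → ℂ} (hF : AEStronglyMeasurable F (V α)) {z : ℂ}
    (h : Integrable (fun w => ‖kernel α z w‖ * ‖F w‖) (V α)) :
    Integrable (fun w => (‖kernel α z w‖ : ℂ) * F w) (V α) :=
  h.mono ((Complex.measurable_ofReal.comp
    (measurable_kernel α).of_uncurry_left.norm).aestronglyMeasurable.mul hF)
    (ae_of_all _ fun w => by simp)

theorem MemOrlicz.const_mul {X : Type*} [MeasurableSpace X] {μ : Measure X} {F : X → ℂ}
    (hF : MemOrlicz Φ μ F) {c : ℂ} (hc : c ≠ 0) : MemOrlicz Φ μ fun x => c * F x := by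
  refine ⟨hF.1.const_mul c, ?_⟩
  have hlt := hF.2
  simp only [luxNorm, iInf_lt_iff] at hlt ⊢
  obtain ⟨l, hl, hle, -⟩ := hlt
  have hc0 : 0 < ‖c‖ := norm_pos_iff.2 hc
  refine ⟨‖c‖ * l, by positivity, ?_, ENNReal.ofReal_lt_top⟩
  simpa only [norm_mul, mul_div_mul_left _ _ hc0.ne'] using hle

/-! ### Radial weights on the disc and the mean value property. -/

theorem integrableOn_polarCoord_symm {f : ℂ → ℂ} (hf : Integrable f) (hm : Measurable f) :
    IntegrableOn (fun p : ℝ × ℝ => p.1 • f (Complex.polarCoord.symm p))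
      (Ioi 0 ×ˢ Ioo (-Real.pi) Real.pi) := by
  have hcont : Measurable fun p : ℝ × ℝ => Complex.polarCoord.symm p := by
    simp only [Complex.polarCoord_symm_apply]
    fun_prop
  refine ⟨(measurable_fst.smul (hm.comp hcont)).aestronglyMeasurable, ?_⟩
  rw [hasFiniteIntegral_iff_enorm]
  calc _ = ∫⁻ p in polarCoord.target,
        ENNReal.ofReal p.1 • ‖f (Complex.polarCoord.symm p)‖ₑ := by
        refine setLIntegral_congr_fun (measurableSet_Ioi.prod measurableSet_Ioo) fun p hp => ?_
        rw [enorm_smul, Real.enorm_of_nonneg (le_of_lt hp.1), smul_eq_mul]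
    _ = ∫⁻ p, ‖f p‖ₑ := Complex.lintegral_comp_polarCoord_symm fun ξ => ‖f ξ‖ₑ
    _ < ∞ := hf.2

theorem integral_circle_of_differentiableOn {H : ℂ → ℂ}
    (hH : DifferentiableOn ℂ H (Metric.ball 0 1)) {r : ℝ} (hr : 0 < r) (hr1 : r < 1) :
    ∫ θ in Ioo (-Real.pi) Real.pi, H (Complex.polarCoord.symm (r, θ)) = 2 * Real.pi * H 0 := by
  have hsub : Metric.closedBall (0 : ℂ) |r| ⊆ Metric.ball 0 1 := by
    rw [abs_of_pos hr]
    exact Metric.closedBall_subset_ball hr1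
  have hd : DiffContOnCl ℂ H (Metric.ball 0 |r|) :=
    (hH.mono (Metric.closure_ball_subset_closedBall.trans hsub)).diffContOnCl
  have h := hd.circleAverage
  rw [Real.circleAverage_eq_integral_add (-Real.pi),
    intervalIntegral.integral_comp_add_right (fun θ => H (circleMap 0 r θ))] at h
  rw [show 0 + -Real.pi = -Real.pi by ring, show 2 * Real.pi + -Real.pi = Real.pi by ring,
    intervalIntegral.integral_of_le (by linarith [Real.pi_pos]), integral_Ioc_eq_integral_Ioo,
    inv_smul_eq_iff₀ (by positivity)] at h
  refine Eq.trans ?_ (h.trans (by rw [Complex.real_smul]; push_cast; rfl))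
  refine integral_congr_ae (ae_of_all _ fun θ => ?_)
  simp [circleMap, Complex.polarCoord_symm_apply, Complex.exp_mul_I]

/-- Integration of a radial weight against a holomorphic function on the unit disc. -/
theorem integral_ball_radial_mul {w : ℝ → ℝ} (hw : Measurable w) {H : ℂ → ℂ}
    (hH : DifferentiableOn ℂ H (Metric.ball 0 1))
    (hi : IntegrableOn (fun ξ => (w ‖ξ‖ : ℂ) * H ξ) (Metric.ball 0 1)) :
    ∫ ξ in Metric.ball (0 : ℂ) 1, (w ‖ξ‖ : ℂ) * H ξ =
      ((2 * Real.pi * ∫ r in (0 : ℝ)..1, r * w r : ℝ) : ℂ) * H 0 := by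
  classical
  set f : ℂ → ℂ := fun ξ => (w ‖ξ‖ : ℂ) * (Metric.ball (0 : ℂ) 1).indicator H ξ with hf
  have hfi : (Metric.ball (0 : ℂ) 1).indicator (fun ξ => (w ‖ξ‖ : ℂ) * H ξ) = f :=
    funext fun _ => indicator_mul_right _ (fun ξ => (w ‖ξ‖ : ℂ)) H
  have hint : Integrable f := by
    rw [← hfi]
    exact hi.integrable_indicator measurableSet_ball
  have hHm : Measurable ((Metric.ball (0 : ℂ) 1).indicator H) := by
    rw [← piecewise_eq_indicator]
    exact hH.continuousOn.measurable_piecewise continuousOn_const measurableSet_ball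
  have hfm : Measurable f :=
    (Complex.measurable_ofReal.comp (hw.comp measurable_norm)).mul hHm
  have hpol := integrableOn_polarCoord_symm hint hfm
  rw [← integral_indicator measurableSet_ball, hfi, ← Complex.integral_comp_polarCoord_symm,
    polarCoord_target, Measure.volume_eq_prod, setIntegral_prod _ hpol]
  calc _ = ∫ r in Ioi (0 : ℝ), (Ioo (0 : ℝ) 1).indicator
        (fun r => ((r * w r : ℝ) : ℂ) * (2 * Real.pi * H 0)) r := by
        refine setIntegral_congr_fun measurableSet_Ioi fun r hr => ?_
        have hr0 : 0 < r := hr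
        have hn : ∀ θ : ℝ, ‖Complex.polarCoord.symm (r, θ)‖ = r := fun θ => by
          rw [Complex.norm_polarCoord_symm, abs_of_pos hr0]
        by_cases hr1 : r < 1
        · rw [indicator_of_mem (show r ∈ Ioo 0 1 from ⟨hr0, hr1⟩),
            ← integral_circle_of_differentiableOn hH hr0 hr1, ← integral_const_mul]
          refine integral_congr_ae (ae_of_all _ fun θ => ?_)
          change r • ((w ‖Complex.polarCoord.symm (r, θ)‖ : ℂ) *
            (Metric.ball (0 : ℂ) 1).indicator H (Complex.polarCoord.symm (r, θ))) = _
          rw [hn, indicator_of_mem (by rw [mem_ball_zero_iff, hn]; exact hr1), Complex.real_smul]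
          push_cast
          ring
        · rw [indicator_of_notMem (fun h => hr1 h.2)]
          refine (integral_congr_ae (ae_of_all _ fun θ => ?_)).trans (integral_zero ℝ ℂ)
          change r • ((w ‖Complex.polarCoord.symm (r, θ)‖ : ℂ) *
            (Metric.ball (0 : ℂ) 1).indicator H (Complex.polarCoord.symm (r, θ))) = 0
          rw [indicator_of_notMem (by rw [mem_ball_zero_iff, hn]; exact hr1), mul_zero, smul_zero]
    _ = ∫ r in Ioo (0 : ℝ) 1, ((r * w r : ℝ) : ℂ) * (2 * Real.pi * H 0) := by
        rw [setIntegral_indicator measurableSet_Ioo,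
          inter_eq_self_of_subset_right Ioo_subset_Ioi_self]
    _ = _ := by
        rw [integral_mul_const, integral_complex_ofReal, ← integral_Ioc_eq_integral_Ioo,
          ← intervalIntegral.integral_of_le zero_le_one]
        push_cast
        ring

/-- For `α < 0` the integrand blows up at `1`; it is integrable as the nonnegative derivative of a
function continuous on the closed interval. -/
theorem integral_mul_one_sub_sq_rpow (hα : -1 < α) :
    ∫ r in (0 : ℝ)..1, r * (1 - r ^ 2) ^ α = 1 / (2 * (α + 1)) := by
  have hα1 : 0 < α + 1 := by linarith
  set g : ℝ → ℝ := fun r => -((1 - r ^ 2) ^ (α + 1) / (2 * (α + 1))) with hg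
  have hcont : ContinuousOn g (Icc 0 1) := by
    refine ContinuousOn.neg (ContinuousOn.div_const ?_ _)
    exact ContinuousOn.rpow_const (by fun_prop) fun r _ => Or.inr hα1.le
  have hpos : ∀ r ∈ Ioo (0 : ℝ) 1, 0 < 1 - r ^ 2 := fun r hr => by nlinarith [hr.1, hr.2]
  have hder : ∀ r ∈ Ioo (0 : ℝ) 1, HasDerivAt g (r * (1 - r ^ 2) ^ α) r := fun r hr => by
    have h1 : HasDerivAt (fun r : ℝ => 1 - r ^ 2) (-(2 * r)) r := by
      simpa using (hasDerivAt_pow 2 r).const_sub 1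
    have h2 := ((h1.rpow_const (p := α + 1) (Or.inl (hpos r hr).ne')).div_const
      (2 * (α + 1))).neg
    refine h2.congr_deriv ?_
    rw [add_sub_cancel_right]
    field_simp
  have hint := intervalIntegral.integrableOn_deriv_of_nonneg hcont hder fun r hr =>
    mul_nonneg hr.1.le (Real.rpow_nonneg (hpos r hr).le _)
  rw [intervalIntegral.integral_eq_sub_of_hasDerivAt_of_le zero_le_one hcont hder
    ((intervalIntegrable_iff_integrableOn_Ioc_of_le zero_le_one).2 hint)]
  simp [hg, Real.zero_rpow hα1.ne']

/-! ### Transfer to the disc and the reproducing formula. -/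

theorem integral_V (α : ℝ) (g : ℂ → ℂ) :
    ∫ w, g w ∂(V α) = ∫ w in upperPlane, (w.im ^ α) • g w := by
  rw [V, integral_withDensity_eq_integral_toReal_smul (by fun_prop)
    (ae_of_all _ fun _ => ENNReal.ofReal_lt_top)]
  refine setIntegral_congr_fun measurableSet_upperPlane fun w hw => ?_
  have hw0 : 0 < w.im := hw
  simp only [ENNReal.toReal_ofReal (Real.rpow_nonneg hw0.le α)]

theorem integrable_V_iff (α : ℝ) (g : ℂ → ℂ) :
    Integrable g (V α) ↔ IntegrableOn (fun w => (w.im ^ α) • g w) upperPlane := by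
  rw [V, integrable_withDensity_iff_integrable_smul' (by fun_prop)
    (ae_of_all _ fun _ => ENNReal.ofReal_lt_top)]
  refine integrableOn_congr_fun (fun w hw => ?_) measurableSet_upperPlane
  have hw0 : 0 < w.im := hw
  simp only [ENNReal.toReal_ofReal (Real.rpow_nonneg hw0.le α)]

/-- The conformal map of the unit disc onto the upper half-plane that sends `0` to `z`. -/
noncomputable def cayley (z ξ : ℂ) : ℂ := (z - conj z * ξ) / (1 - ξ)

theorem one_sub_ne_zero_of_mem_ball {ξ : ℂ} (hξ : ξ ∈ Metric.ball (0 : ℂ) 1) : 1 - ξ ≠ 0 := by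
  rintro h
  rw [← sub_eq_zero.1 h] at hξ
  simp at hξ

theorem one_sub_mem_slitPlane {ξ : ℂ} (hξ : ξ ∈ Metric.ball (0 : ℂ) 1) :
    1 - ξ ∈ Complex.slitPlane := by
  left
  have := Complex.re_le_norm ξ
  rw [mem_ball_zero_iff] at hξ
  simp only [Complex.sub_re, Complex.one_re]
  linarith

theorem cayley_zero (z : ℂ) : cayley z 0 = z := by simp [cayley]

theorem cayley_im (z : ℂ) {ξ : ℂ} (hξ : 1 - ξ ≠ 0) :
    (cayley z ξ).im = z.im * (1 - ‖ξ‖ ^ 2) / ‖1 - ξ‖ ^ 2 := by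
  have h : Complex.normSq (1 - ξ) ≠ 0 := by simpa using hξ
  rw [cayley, Complex.div_im, ← Complex.normSq_eq_norm_sq, ← Complex.normSq_eq_norm_sq]
  field_simp
  simp [Complex.normSq_apply]
  ring

theorem sub_conj_cayley (z : ℂ) {ξ : ℂ} (hξ : 1 - ξ ≠ 0) :
    (z - conj (cayley z ξ)) / Complex.I = ((2 * z.im : ℝ) : ℂ) * (1 - conj ξ)⁻¹ := by
  have h : 1 - conj ξ ≠ 0 := by
    rw [← map_one (starRingEnd ℂ), ← map_sub]
    exact (map_ne_zero _).2 hξ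
  have h2 : z - conj z = ((2 * z.im : ℝ) : ℂ) * Complex.I := Complex.sub_conj z
  have h3 : z - conj (cayley z ξ) = (z - conj z) * (1 - conj ξ)⁻¹ := by
    simp only [cayley, map_div₀, map_sub, map_mul, Complex.conj_conj, map_one]
    field_simp
    ring
  rw [h3, h2]
  field_simp

theorem cayley_image {z : ℂ} (hz : z ∈ upperPlane) :
    cayley z '' Metric.ball 0 1 = upperPlane := by
  have hz0 : 0 < z.im := hz
  ext w
  constructor
  · rintro ⟨ξ, hξ, rfl⟩
    have h1 := one_sub_ne_zero_of_mem_ball hξ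
    have h2 : 0 < ‖1 - ξ‖ := norm_pos_iff.2 h1
    rw [mem_ball_zero_iff] at hξ
    change 0 < (cayley z ξ).im
    rw [cayley_im z h1]
    have : 0 < 1 - ‖ξ‖ ^ 2 := by nlinarith [norm_nonneg ξ]
    positivity
  · intro hw
    have hw0 : 0 < w.im := hw
    have hd : w - conj z ≠ 0 := fun h => by
      have := congrArg Complex.im h
      simp at this
      linarith
    have hzz : z - conj z ≠ 0 := fun h => by
      have := congrArg Complex.im h
      simp at this
      linarith
    have h1 : 1 - (w - z) / (w - conj z) = (z - conj z) / (w - conj z) := by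
      field_simp
      ring
    have h1' : 1 - (w - z) / (w - conj z) ≠ 0 := by
      rw [h1]
      exact div_ne_zero hzz hd
    have hc : cayley z ((w - z) / (w - conj z)) = w := by
      rw [cayley, h1]
      field_simp
      ring
    -- The preimage lies in the disc because, by `cayley_im`, `w.im` has the sign of `1 - ‖ξ‖ ^ 2`.
    refine ⟨(w - z) / (w - conj z), ?_, hc⟩
    have h2 := cayley_im z h1'
    have h3 : 0 < ‖1 - (w - z) / (w - conj z)‖ := norm_pos_iff.2 h1'
    rw [hc] at h2
    rw [h2] at hw0
    rw [mem_ball_zero_iff]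
    by_contra! hge
    have : z.im * (1 - ‖(w - z) / (w - conj z)‖ ^ 2) / ‖1 - (w - z) / (w - conj z)‖ ^ 2 ≤ 0 :=
      div_nonpos_of_nonpos_of_nonneg (mul_nonpos_of_nonneg_of_nonpos hz0.le (by nlinarith))
        (by positivity)
    linarith

theorem cayley_injOn {z : ℂ} (hz : z ∈ upperPlane) : InjOn (cayley z) (Metric.ball 0 1) := by
  have hz0 : 0 < z.im := hz
  intro ξ hξ η hη h
  have hzz : z - conj z ≠ 0 := fun h => by
    have := congrArg Complex.im h
    simp at this
    linarith
  rw [cayley, cayley, div_eq_div_iff (one_sub_ne_zero_of_mem_ball hξ)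
    (one_sub_ne_zero_of_mem_ball hη)] at h
  have : (z - conj z) * (ξ - η) = 0 := by linear_combination h
  exact sub_eq_zero.1 ((mul_eq_zero.1 this).resolve_left hzz)

theorem hasDerivAt_cayley (z : ℂ) {ξ : ℂ} (hξ : 1 - ξ ≠ 0) :
    HasDerivAt (cayley z) ((z - conj z) / (1 - ξ) ^ 2) ξ := by
  have h1 : HasDerivAt (fun ξ => z - conj z * ξ) (-(conj z * 1)) ξ :=
    ((hasDerivAt_id ξ).const_mul (conj z)).const_sub z
  have h2 : HasDerivAt (fun ξ : ℂ => 1 - ξ) (-1) ξ := (hasDerivAt_id ξ).const_sub 1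
  refine (h1.div h2 hξ).congr_deriv ?_
  congr 1
  ring

theorem det_restrictScalars_toSpanSingleton (a : ℂ) :
    ((ContinuousLinearMap.toSpanSingleton ℂ a).restrictScalars ℝ : ℂ →L[ℝ] ℂ).det = ‖a‖ ^ 2 := by
  simp [ContinuousLinearMap.det, LinearMap.det_restrictScalars, Algebra.norm_complex_eq,
    Complex.normSq_eq_norm_sq]

/-- A positive factor does not move the argument, so the principal logarithm is additive here. -/
theorem ofReal_mul_cpow {r : ℝ} (hr : 0 < r) {x : ℂ} (hx : x ≠ 0) (c : ℂ) :
    ((r : ℂ) * x) ^ c = (r : ℂ) ^ c * x ^ c := by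
  have hr0 : (r : ℂ) ≠ 0 := Complex.ofReal_ne_zero.2 hr.ne'
  rw [Complex.cpow_def_of_ne_zero (mul_ne_zero hr0 hx), Complex.cpow_def_of_ne_zero hr0,
    Complex.cpow_def_of_ne_zero hx, Complex.log_ofReal_mul hr hx, Complex.ofReal_log hr.le,
    add_mul, Complex.exp_add]

/-- The Bergman integrand in the coordinates of the disc. -/
theorem kernel_mul_comp_cayley (G : ℂ → ℂ) {z : ℂ} (hz : z ∈ upperPlane) {ξ : ℂ}
    (hξ : ξ ∈ Metric.ball (0 : ℂ) 1) :
    ‖(z - conj z) / (1 - ξ) ^ 2‖ ^ 2 •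
        ((cayley z ξ).im ^ α • (kernel α z (cayley z ξ) * G (cayley z ξ))) =
      ((2 ^ (-α) * (1 - ‖ξ‖ ^ 2) ^ α : ℝ) : ℂ) *
        (G (cayley z ξ) * ((1 - ξ) ^ ((α + 2 : ℝ) : ℂ))⁻¹) := by
  have hy : 0 < z.im := hz
  have h1 := one_sub_ne_zero_of_mem_ball hξ
  have hn : 0 < ‖1 - ξ‖ := norm_pos_iff.2 h1
  have hslit := one_sub_mem_slitPlane hξ
  have hξ2 : 0 < 1 - ‖ξ‖ ^ 2 := by
    rw [mem_ball_zero_iff] at hξ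
    nlinarith [norm_nonneg ξ]
  set g : ℂ := (1 - ξ) ^ ((α + 2 : ℝ) : ℂ) with hg
  have hgn : ‖g‖ = ‖1 - ξ‖ ^ (α + 2) := Complex.norm_cpow_real _ _
  have hg0 : g ≠ 0 := by
    rw [← norm_pos_iff, hgn]
    positivity
  have hconj : (1 - conj ξ) ^ ((α + 2 : ℝ) : ℂ) = conj g := by
    have := Complex.conj_cpow (1 - ξ) ((α + 2 : ℝ) : ℂ) (Complex.slitPlane_arg_ne_pi hslit)
    rwa [Complex.conj_ofReal, map_sub, map_one] at this
  have hcslit : (1 - conj ξ) ∈ Complex.slitPlane := by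
    refine one_sub_mem_slitPlane ?_
    simpa using hξ
  have hK : kernel α z (cayley z ξ) = (((2 * z.im) ^ (-α - 2) : ℝ) : ℂ) * conj g := by
    have hc0 : (1 - conj ξ)⁻¹ ≠ 0 := inv_ne_zero (Complex.slitPlane_ne_zero hcslit)
    rw [kernel, sub_conj_cayley z h1, ofReal_mul_cpow (by positivity) hc0,
      Complex.inv_cpow _ _ (Complex.slitPlane_arg_ne_pi hcslit), ← Complex.cpow_neg,
      ← Complex.ofReal_cpow (by positivity), ← hconj]
    congr 2
    push_cast
    ring
  -- This trades the antiholomorphic factor of the kernel for a holomorphic one; the modulus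
  -- produced cancels the powers of `‖1 - ξ‖` from the Jacobian and from `(cayley z ξ).im ^ α`.
  have hgg : conj g = (((‖1 - ξ‖ ^ (α + 2)) ^ 2 : ℝ) : ℂ) * g⁻¹ := by
    rw [← hgn]
    push_cast
    rw [← Complex.mul_conj']
    field_simp
  have hzz : ‖z - conj z‖ = 2 * z.im := by
    rw [Complex.sub_conj, norm_mul, Complex.norm_I, mul_one, Complex.norm_real,
      Real.norm_of_nonneg (by positivity)]
  have hreal : ‖(z - conj z) / (1 - ξ) ^ 2‖ ^ 2 * (z.im * (1 - ‖ξ‖ ^ 2) / ‖1 - ξ‖ ^ 2) ^ α *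
      (2 * z.im) ^ (-α - 2) * (‖1 - ξ‖ ^ (α + 2)) ^ 2 = 2 ^ (-α) * (1 - ‖ξ‖ ^ 2) ^ α := by
    have e1 : (‖1 - ξ‖ ^ 2) ^ α = (‖1 - ξ‖ ^ α) ^ 2 := by
      rw [← Real.rpow_natCast, ← Real.rpow_natCast, ← Real.rpow_mul hn.le, ← Real.rpow_mul hn.le,
        mul_comm]
    have e2 : (2 * z.im) ^ (-α - 2) = 2 ^ (-α) * (z.im ^ α)⁻¹ / (2 * z.im) ^ 2 := by
      rw [Real.rpow_sub (by positivity), Real.mul_rpow two_pos.le hy.le, Real.rpow_neg hy.le,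
        Real.rpow_two]
    rw [norm_div, norm_pow, hzz, Real.div_rpow (by positivity) (by positivity),
      Real.mul_rpow hy.le hξ2.le, e1, e2, Real.rpow_add hn, Real.rpow_two]
    have : 0 < z.im ^ α := by positivity
    have : 0 < ‖1 - ξ‖ ^ α := by positivity
    field_simp
  rw [cayley_im z h1, hK, hgg, ← hreal, Complex.real_smul, Complex.real_smul]
  push_cast
  ring

/-- The reproducing formula of the Bergman kernel. -/
theorem bergmanProj_eq_of_differentiableOn (hα : -1 < α) {G : ℂ → ℂ}
    (hG : DifferentiableOn ℂ G upperPlane) {z : ℂ} (hz : z ∈ upperPlane)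
    (hi : Integrable (fun w => kernel α z w * G w) (V α)) :
    bergmanProj α G z = ((2 ^ (-α) * Real.pi / (α + 1) : ℝ) : ℂ) * G z := by
  have hα1 : 0 < α + 1 := by linarith
  set f : ℂ → ℂ := fun w => w.im ^ α • (kernel α z w * G w) with hf
  set f' : ℂ → ℂ →L[ℝ] ℂ := fun ξ =>
    (ContinuousLinearMap.toSpanSingleton ℂ ((z - conj z) / (1 - ξ) ^ 2)).restrictScalars ℝ with hf'
  set H : ℂ → ℂ := fun ξ => G (cayley z ξ) * ((1 - ξ) ^ ((α + 2 : ℝ) : ℂ))⁻¹ with hH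
  set wt : ℝ → ℝ := fun r => 2 ^ (-α) * (1 - r ^ 2) ^ α with hwt
  have hderiv : ∀ ξ ∈ Metric.ball (0 : ℂ) 1,
      HasFDerivWithinAt (cayley z) (f' ξ) (Metric.ball 0 1) ξ := fun ξ hξ =>
    ((hasDerivAt_cayley z (one_sub_ne_zero_of_mem_ball hξ)).hasFDerivAt.restrictScalars
      ℝ).hasFDerivWithinAt
  have hcv : ∀ ξ ∈ Metric.ball (0 : ℂ) 1,
      |(f' ξ).det| • f (cayley z ξ) = (wt ‖ξ‖ : ℂ) * H ξ := fun ξ hξ => by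
    rw [← kernel_mul_comp_cayley G hz hξ, hf', det_restrictScalars_toSpanSingleton,
      abs_of_nonneg (by positivity)]
  have hHd : DifferentiableOn ℂ H (Metric.ball 0 1) := by
    refine DifferentiableOn.mul ?_ ?_
    · refine hG.comp (fun ξ hξ => (hasDerivAt_cayley z
        (one_sub_ne_zero_of_mem_ball hξ)).differentiableAt.differentiableWithinAt) ?_
      rw [← cayley_image hz]
      exact mapsTo_image _ _
    · intro ξ hξ
      have hs := one_sub_mem_slitPlane hξ
      have h1 := ((hasDerivAt_id ξ).const_sub 1).cpow_const (c := ((α + 2 : ℝ) : ℂ)) hs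
      refine (h1.differentiableAt.inv ?_).differentiableWithinAt
      exact fun h => Complex.slitPlane_ne_zero hs (Complex.cpow_eq_zero_iff _ _ |>.1 h).1
  have hHi : IntegrableOn (fun ξ => (wt ‖ξ‖ : ℂ) * H ξ) (Metric.ball 0 1) := by
    have h1 := (integrable_V_iff α _).1 hi
    rw [← cayley_image hz, integrableOn_image_iff_integrableOn_abs_det_fderiv_smul volume
      measurableSet_ball hderiv (cayley_injOn hz)] at h1
    exact (integrableOn_congr_fun hcv measurableSet_ball).1 h1
  have hwint : ∫ r in (0 : ℝ)..1, r * wt r = 2 ^ (-α) * (1 / (2 * (α + 1))) := by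
    rw [← integral_mul_one_sub_sq_rpow hα, ← intervalIntegral.integral_const_mul]
    refine intervalIntegral.integral_congr fun r _ => ?_
    simp only [hwt]
    ring
  rw [bergmanProj, integral_V, ← cayley_image hz,
    integral_image_eq_integral_abs_det_fderiv_smul volume measurableSet_ball hderiv
      (cayley_injOn hz), setIntegral_congr_fun measurableSet_ball hcv,
    integral_ball_radial_mul (by fun_prop) hHd hHi, hwint]
  have hH0 : H 0 = G z := by simp [hH, cayley_zero]
  rw [hH0]
  congr 2
  field_simp

end BergmanOrlicz

/-! ### The main theorem. -/

open BergmanOrlicz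
theorem mainTheorem4 (α : ℝ) (hα : -1 < α) (Φ : ℝ → ℝ) (hΦ : ClassU Φ) (hΦ₂ : Nabla2 Φ) :
    -- `P_α` is well defined and bounded from `L^Φ` into `A^Φ_α`
    ((∃ C : ℝ≥0, ∀ F : ℂ → ℂ, MemOrlicz Φ (V α) F →
        (∀ z ∈ upperPlane, Integrable (fun w => kernel α z w * F w) (V α)) ∧
        MemBergmanOrlicz Φ α (bergmanProj α F) ∧
        luxNorm Φ (V α) (bergmanProj α F) ≤ C * luxNorm Φ (V α) F) ∧
      -- and it is onto `A^Φ_α`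
      (∀ G : ℂ → ℂ, MemBergmanOrlicz Φ α G →
        ∃ F : ℂ → ℂ, MemOrlicz Φ (V α) F ∧ EqOn (bergmanProj α F) G upperPlane)) ∧
    -- `P⁺_α` is well defined and bounded on `L^Φ`
    (∃ C : ℝ≥0, ∀ F : ℂ → ℂ, MemOrlicz Φ (V α) F →
        (∀ z ∈ upperPlane, Integrable (fun w => (‖kernel α z w‖ : ℂ) * F w) (V α)) ∧
        MemOrlicz Φ (V α) (bergmanPos α F) ∧
        luxNorm Φ (V α) (bergmanPos α F) ≤ C * luxNorm Φ (V α) F) := by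
  obtain ⟨D, hD⟩ := hΦ.exists_luxNorm_le hα hΦ₂
  have hlt : ∀ F : ℂ → ℂ, MemOrlicz Φ (V α) F → D * luxNorm Φ (V α) F < ∞ :=
    fun F hF => ENNReal.mul_lt_top ENNReal.coe_lt_top hF.2
  refine ⟨⟨⟨D, fun F hF => ?_⟩, fun G hG => ?_⟩, D, fun F hF => ?_⟩
  · have hint := fun z hz => integrable_kernel_mul hF.1 ((hD F hF).1 z hz)
    have hle := (hD F hF).2 (bergmanProj α F) fun z _ =>
      (norm_integral_le_integral_norm _).trans_eq (by simp only [norm_mul])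
    have hdiff := differentiableOn_bergmanProj hα hF.1 hint
    exact ⟨hint, ⟨hdiff, aestronglyMeasurable_of_differentiableOn hdiff, hle.trans_lt (hlt F hF)⟩,
      hle⟩
  · have hα1 : 0 < α + 1 := by linarith
    set c : ℂ := ((2 ^ (-α) * Real.pi / (α + 1) : ℝ) : ℂ) with hc
    have hc0 : c ≠ 0 := Complex.ofReal_ne_zero.2 (by positivity)
    -- The kernel carries no normalizing constant, so `G` is reproduced only up to `c`; the preimage
    -- is `c⁻¹ * G`.
    have hF := hG.2.const_mul (inv_ne_zero hc0)
    refine ⟨_, hF, fun z hz => ?_⟩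
    rw [bergmanProj_eq_of_differentiableOn hα (hG.1.const_mul _) hz
      (integrable_kernel_mul hF.1 ((hD _ hF).1 z hz)), ← hc, mul_inv_cancel_left₀ hc0]
  · have hle := (hD F hF).2 (bergmanPos α F) fun z _ =>
      (norm_integral_le_integral_norm _).trans_eq (by simp)
    exact ⟨fun z hz => integrable_norm_kernel_mul hF.1 ((hD F hF).1 z hz),
      ⟨aestronglyMeasurable_bergmanPos hF.1, hle.trans_lt (hlt F hF)⟩, hle⟩
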